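/- All semirings are commutative with $0$ and $1$ (with $a\cdot 0=0$), and homomorphisms preserve $+,\cdot,0,1$. An ideal of a semiring $A$ is a subset containing $0$ and closed under addition and under multiplication by elements of $A$; a proper ideal $\mathfrak p$ is prime if $ab\in\mathfrak p$ implies $a\in\mathfrak p$ or $b\in\mathfrak p$, and $A_{\mathfrak p}$ denotes the localization of $A$ at $A\setminus\mathfrak p$. Let $\operatorname{Spec}A$ be the set of all prime ideals of $A$ with the Zariski topology. Its structure sheaf $\mathcal O_{\operatorname{Spec}A}$ assigns to an open set $U$ the semiring of functions $s\colon U\to\coprod_{\mathfrak p\in U}A_{\mathfrak p}$ with $s(\mathfrak p)\in A_{\mathfrak p}$ that are locally quotients of elements of $A$: every $\mathfrak p\in U$ has an open neighbourhood $V\subseteq U$ and elements $a,f\in A$ such that $f\notin\mathfrak q$ and $s(\mathfrak q)=a/f$ in $A_{\mathfrak q}$ for all $\mathfrak q\in V$. A locally semiringed space is a topological space $X$ with a sheaf $\mathcal O_X$ of commutative semirings all of whose stalks are local semirings. A morphism $X\to Y$ is a continuous map $f\colon X\to Y$ together with a morphism of sheaves of semirings $f^\#\colon\mathcal O_Y\to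 f_*\mathcal O_X$ such that for every $x\in X$ the induced homomorphism $\mathcal O_{Y,f(x)}\to\mathcal O_{X,x}$ is local (it maps the maximal ideal into the maximal ideal). An affine semischeme is a locally semiringed space isomorphic to $(\operatorname{Spec}A,\mathcal O_{\operatorname{Spec}A})$ for some commutative semiring $A$; affine semischemes form a full subcategory of the category of locally semiringed spaces. A homomorphism $\varphi\colon A\to B$ induces the morphism $\operatorname{Spec}B\to\operatorname{Spec}A$ given by $\mathfrak p\mapsto\varphi^{-1}(\mathfrak p)$ and, on sections, by sending $s$ to the section whose value at $\mathfrak p$ is the image of $s(\varphi^{-1}(\mathfrak p))$ under the homomorphism $A_{\varphi^{-1}(\mathfrak p)}\to B_{\mathfrak p}$ induced by $\varphi$. This makes $\operatorname{Spec}$ a contravariant functor. **Proposition.** The contravariant functor $$\operatorname{Spec}\colon A\longmapsto(\operatorname{Spec}A,\mathcal O_{\operatorname{Spec}A})$$ is an anti-equivalence between the category of commutative semirings and the category of affine semischemes, with quasi-inverse the global sections functor $(X,\mathcal O_X)\mapsto\mathcal O_X(X)$. -/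

import Mathlib

open CategoryTheory CategoryTheory.Limits TopologicalSpace Opposite AlgebraicGeometry

universe u

noncomputable section

/-! ## Colimits of commutative semirings

Small colimits exist in the category of commutative semirings: take the polynomial semiring over `ℕ`
on all elements of the diagram and divide by the congruence generated by the obvious relations.
This is what makes stalks of sheaves of commutative semirings available. -/

namespace CommSemiRingCat.Colim

variable {J : Type u} [SmallCategory J] (F : J ⥤ CommSemiRingCat.{u})

/-- The polynomial semiring on the disjoint union of the semirings of a diagram. -/
abbrev Free : Type u := MvPolynomial (Σ j, F.obj j) ℕ

/-- The relations defining the colimit. -/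
inductive Rel : Free F → Free F → Prop
  | map {i j : J} (f : i ⟶ j) (x : F.obj i) :
      Rel (MvPolynomial.X ⟨i, x⟩) (MvPolynomial.X ⟨j, F.map f x⟩)
  | zero (j : J) : Rel (MvPolynomial.X ⟨j, 0⟩) 0
  | one (j : J) : Rel (MvPolynomial.X ⟨j, 1⟩) 1
  | add (j : J) (x y : F.obj j) :
      Rel (MvPolynomial.X ⟨j, x + y⟩) (MvPolynomial.X ⟨j, x⟩ + MvPolynomial.X ⟨j, y⟩)
  | mul (j : J) (x y : F.obj j) :
      Rel (MvPolynomial.X ⟨j, x * y⟩) (MvPolynomial.X ⟨j, x⟩ * MvPolynomial.X ⟨j, y⟩)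

/-- The congruence generated by the relations. -/
abbrev con : RingCon (Free F) := ringConGen (Rel F)

/-- The structure map of the colimit at `j`. -/
def toQuot (j : J) : F.obj j →+* (con F).Quotient where
  toFun x := (con F).mk' (MvPolynomial.X ⟨j, x⟩)
  map_zero' := by
    rw [← map_zero (con F).mk']
    exact (RingCon.eq _).2 (RingConGen.Rel.of _ _ (Rel.zero j))
  map_one' := by
    rw [← map_one (con F).mk']
    exact (RingCon.eq _).2 (RingConGen.Rel.of _ _ (Rel.one j))
  map_add' x y := by
    rw [← map_add (con F).mk']
    exact (RingCon.eq _).2 (RingConGen.Rel.of _ _ (Rel.add j x y))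
  map_mul' x y := by
    rw [← map_mul (con F).mk']
    exact (RingCon.eq _).2 (RingConGen.Rel.of _ _ (Rel.mul j x y))

/-- The colimit cocone. -/
def cocone : Cocone F where
  pt := CommSemiRingCat.of (con F).Quotient
  ι :=
    { app := fun j => CommSemiRingCat.ofHom (toQuot F j)
      naturality := fun i j f => by
        ext x
        exact ((RingCon.eq _).2 (RingConGen.Rel.of _ _ (Rel.map f x))).symm }

variable {F}

/-- The evaluation map on the free object that a cocone induces. -/
def freeDesc (s : Cocone F) : Free F →+* s.pt :=
  MvPolynomial.eval₂Hom (Nat.castRingHom s.pt) fun p => s.ι.app p.1 p.2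

theorem freeDesc_X (s : Cocone F) (j : J) (x : F.obj j) :
    freeDesc s (MvPolynomial.X ⟨j, x⟩) = s.ι.app j x := by
  simp [freeDesc]

theorem con_le (s : Cocone F) : con F ≤ RingCon.ker (freeDesc s) := by
  refine RingCon.ringConGen_le.2 fun a b h => ?_
  rw [RingCon.ker_apply]
  cases h with
  | map f x =>
    rw [freeDesc_X, freeDesc_X, ← s.w f]
    rfl
  | zero j => rw [freeDesc_X, map_zero, map_zero]
  | one j => rw [freeDesc_X, map_one, map_one]
  | add j x y => rw [freeDesc_X, map_add, map_add, freeDesc_X, freeDesc_X]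
  | mul j x y => rw [freeDesc_X, map_mul, map_mul, freeDesc_X, freeDesc_X]

variable (F) in
/-- The cocone is a colimit cocone. -/
def isColimit : IsColimit (cocone F) where
  desc s := CommSemiRingCat.ofHom ((con F).lift (freeDesc s) (con_le s))
  fac s j := by
    ext x
    exact freeDesc_X s j x
  uniq s m hm := by
    apply CommSemiRingCat.hom_ext
    apply RingCon.Quotient.hom_ext
    apply MvPolynomial.ringHom_ext
    · intro n
      simp
    · rintro ⟨j, x⟩
      have h : (cocone F).ι.app j ≫ m = s.ι.app j := hm j
      exact (ConcreteCategory.congr_hom h x).trans (freeDesc_X s j x).symm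

end CommSemiRingCat.Colim

instance CommSemiRingCat.instHasColimits : HasColimits CommSemiRingCat.{u} where
  has_colimits_of_shape _ _ :=
    { has_colimit := fun F =>
        ⟨⟨⟨CommSemiRingCat.Colim.cocone F, CommSemiRingCat.Colim.isColimit F⟩⟩⟩ }

/-! ## The structure sheaf on the prime spectrum of a commutative semiring -/

namespace SemiSpec

/-- The topological space of prime ideals of a commutative semiring, with the Zariski topology. -/
abbrev top (A : Type u) [CommSemiring A] : TopCat.{u} := TopCat.of (PrimeSpectrum A)

section

variable {A : Type u} [CommSemiring A]

/-- The localization of `A` at the prime ideal `p`. -/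
abbrev Loc (p : top A) : Type u := Localization.AtPrime (PrimeSpectrum.asIdeal p)

/-- A dependent function `s` on `U` with `s p` in the localization at `p` is a fraction if there are
`a` and `f` in `A` such that for every `p` in `U` one has `f ∉ p` and `s p = a / f`. -/
def isFraction (A : Type u) [CommSemiring A] :
    TopCat.PrelocalPredicate (fun p : top A => Loc p) where
  pred {U} s := ∃ a f : A, ∀ p : U, ∃ h : f ∉ PrimeSpectrum.asIdeal p.1,
    s p = Localization.mk a ⟨f, h⟩
  res := by
    rintro V U i s ⟨a, f, w⟩
    exact ⟨a, f, fun p => w ⟨p.1, i.le p.2⟩⟩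

/-- The condition of being locally a fraction. -/
def isLocallyFraction (A : Type u) [CommSemiring A] :
    TopCat.LocalPredicate (fun p : top A => Loc p) :=
  (isFraction A).sheafify

/-- The semiring of sections on `U`: functions `s` on `U` with `s p` in the localization of `A`
at `p` that are locally quotients of elements of `A`. -/
def sections (A : Type u) [CommSemiring A] (U : Opens (top A)) :
    Subsemiring (∀ p : U, Loc p.1) where
  carrier := { s | (isLocallyFraction A).pred s }
  zero_mem' p := ⟨U, p.2, 𝟙 _, 0, 1, fun q =>
    ⟨(Ideal.ne_top_iff_one _).1 q.1.isPrime.ne_top, (Localization.mk_zero _).symm⟩⟩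
  one_mem' p := ⟨U, p.2, 𝟙 _, 1, 1, fun q =>
    ⟨(Ideal.ne_top_iff_one _).1 q.1.isPrime.ne_top, Localization.mk_one.symm⟩⟩
  add_mem' {s t} hs ht p := by
    obtain ⟨V, hV, i, a, f, hs⟩ := hs p
    obtain ⟨W, hW, j, b, g, ht⟩ := ht p
    refine ⟨V ⊓ W, ⟨hV, hW⟩, Opens.infLELeft _ _ ≫ i, f * b + g * a, f * g, fun q => ?_⟩
    obtain ⟨hf, hs⟩ := hs ⟨q.1, q.2.1⟩
    obtain ⟨hg, ht⟩ := ht ⟨q.1, q.2.2⟩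
    exact ⟨(PrimeSpectrum.asIdeal q.1).primeCompl.mul_mem hf hg,
      (congrArg₂ (· + ·) hs ht).trans (Localization.add_mk a ⟨f, hf⟩ b ⟨g, hg⟩)⟩
  mul_mem' {s t} hs ht p := by
    obtain ⟨V, hV, i, a, f, hs⟩ := hs p
    obtain ⟨W, hW, j, b, g, ht⟩ := ht p
    refine ⟨V ⊓ W, ⟨hV, hW⟩, Opens.infLELeft _ _ ≫ i, a * b, f * g, fun q => ?_⟩
    obtain ⟨hf, hs⟩ := hs ⟨q.1, q.2.1⟩
    obtain ⟨hg, ht⟩ := ht ⟨q.1, q.2.2⟩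
    exact ⟨(PrimeSpectrum.asIdeal q.1).primeCompl.mul_mem hf hg,
      (congrArg₂ (· * ·) hs ht).trans (Localization.mk_mul a b ⟨f, hf⟩ ⟨g, hg⟩)⟩

/-- Restriction of sections. -/
def res {U V : Opens (top A)} (i : V ⟶ U) : sections A U →+* sections A V where
  toFun s := ⟨fun p => s.1 ⟨p.1, i.le p.2⟩, (isLocallyFraction A).res i s.1 s.2⟩
  map_zero' := rfl
  map_one' := rfl
  map_add' _ _ := rfl
  map_mul' _ _ := rfl

/-- The structure sheaf, as a presheaf of commutative semirings. -/
def presheaf (A : Type u) [CommSemiring A] : TopCat.Presheaf CommSemiRingCat.{u} (top A) where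
  obj U := CommSemiRingCat.of (sections A U.unop)
  map i := CommSemiRingCat.ofHom (res i.unop)
  map_id _ := rfl
  map_comp _ _ := rfl

theorem presheaf_isSheaf (A : Type u) [CommSemiring A] : (presheaf A).IsSheaf :=
  (TopCat.Presheaf.isSheaf_iff_isSheaf_comp (forget CommSemiRingCat.{u}) _).2
    (TopCat.Presheaf.isSheaf_of_iso
      (NatIso.ofComponents (fun _ => Iso.refl _) (fun _ => rfl) :
        TopCat.subpresheafToTypes (isLocallyFraction A).toPrelocalPredicate ≅
          presheaf A ⋙ forget CommSemiRingCat.{u})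
      (TopCat.subpresheafToTypes.isSheaf (isLocallyFraction A)))

/-- Evaluation of a section at a point. -/
def eval (U : Opens (top A)) (p : top A) (hp : p ∈ U) : sections A U →+* Loc p where
  toFun s := s.1 ⟨p, hp⟩
  map_zero' := rfl
  map_one' := rfl
  map_add' _ _ := rfl
  map_mul' _ _ := rfl

/-- Evaluation of a germ at its point. -/
def stalkEval (p : top A) : (presheaf A).stalk p ⟶ CommSemiRingCat.of (Loc p) :=
  colimit.desc _
    { pt := CommSemiRingCat.of (Loc p)
      ι :=
        { app := fun U => CommSemiRingCat.ofHom (eval U.unop.1 p U.unop.2)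
          naturality := fun _ _ _ => rfl } }

theorem stalkEval_germ (p : top A) (U : Opens (top A)) (hp : p ∈ U) (s : sections A U) :
    stalkEval p ((presheaf A).germ U p hp s) = eval U p hp s :=
  ConcreteCategory.congr_hom (colimit.ι_desc (F := (OpenNhds.inclusion p).op ⋙ presheaf A) _
    (op ⟨U, hp⟩)) s

/-- A germ whose value is invertible is invertible. -/
instance isLocalHom_stalkEval (p : top A) : IsLocalHom (stalkEval p).hom where
  map_nonunit x hx := by
    obtain ⟨U, hp, s, rfl⟩ := TopCat.Presheaf.exists_germ_eq (presheaf A) x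
    change sections A U at s
    replace hx : IsUnit (s.1 ⟨p, hp⟩) := by
      have h := stalkEval_germ p U hp s
      change _ = s.1 ⟨p, hp⟩ at h
      rw [← h]
      exact hx
    obtain ⟨V, hV, i, a, f, hs⟩ := s.2 ⟨p, hp⟩
    have ha : a ∉ PrimeSpectrum.asIdeal p := by
      obtain ⟨hf, h⟩ := hs ⟨p, hV⟩
      have h' : s.1 ⟨p, hp⟩ = Localization.mk a ⟨f, hf⟩ := h
      rw [h', Localization.mk_eq_mk'] at hx
      exact (IsLocalization.AtPrime.isUnit_mk'_iff _ (PrimeSpectrum.asIdeal p) a ⟨f, hf⟩).1 hx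
    let W : Opens (top A) := V ⊓ PrimeSpectrum.basicOpen a
    have hW : p ∈ W := ⟨hV, ha⟩
    let j : W ⟶ U := Opens.infLELeft _ _ ≫ i
    let t : sections A W := ⟨fun q => Localization.mk f ⟨a, q.2.2⟩, fun q =>
      ⟨W, q.2, 𝟙 _, f, a, fun r => ⟨r.2.2, rfl⟩⟩⟩
    have hst : res j s * t = 1 := by
      apply Subtype.ext
      funext q
      obtain ⟨hf, h⟩ := hs ⟨q.1, q.2.1⟩
      change s.1 ⟨q.1, j.le q.2⟩ * Localization.mk f ⟨a, q.2.2⟩ = 1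
      have h' : s.1 ⟨q.1, j.le q.2⟩ = Localization.mk a ⟨f, hf⟩ := h
      rw [h', Localization.mk_mul]
      have e : (⟨f, hf⟩ * ⟨a, q.2.2⟩ : (PrimeSpectrum.asIdeal q.1).primeCompl) =
        ⟨a * f, (PrimeSpectrum.asIdeal q.1).primeCompl.mul_mem q.2.2 hf⟩ :=
          Subtype.ext (mul_comm f a)
      exact (congrArg (Localization.mk (a * f)) e).trans (Localization.mk_self
        (⟨a * f, (PrimeSpectrum.asIdeal q.1).primeCompl.mul_mem q.2.2 hf⟩ :
          (PrimeSpectrum.asIdeal q.1).primeCompl))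
    have hu : IsUnit (res j s) := IsUnit.of_mul_eq_one _ hst
    have := hu.map ((presheaf A).germ W p hW).hom
    have e : (presheaf A).germ W p hW ((presheaf A).map j.op s) = (presheaf A).germ U p hp s :=
      TopCat.Presheaf.germ_res_apply (presheaf A) j p hW s
    rw [← e]
    exact this

theorem isLocalRing_stalk (p : top A) : IsLocalRing ((presheaf A).stalk p) :=
  RingHom.domain_isLocalRing (stalkEval p).hom

end

section

variable {A B : Type u} [CommSemiring A] [CommSemiring B]

/-- The continuous map `p ↦ φ⁻¹(p)` induced by a homomorphism `φ`. -/
def topMap (φ : A →+* B) : top B ⟶ top A :=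
  TopCat.ofHom ⟨PrimeSpectrum.comap φ, PrimeSpectrum.continuous_comap φ⟩

/-- The map on sections induced by a homomorphism `φ`: a section `s` is sent to the section whose
value at `p` is the image of `s (φ⁻¹(p))` under the homomorphism `A_{φ⁻¹(p)} → B_p` induced
by `φ`. -/
def sectionsMap (φ : A →+* B) (U : Opens (top A)) :
    sections A U →+* sections B ((Opens.map (topMap φ)).obj U) where
  toFun s := ⟨fun p => Localization.localRingHom (PrimeSpectrum.comap φ p.1).asIdeal
      (PrimeSpectrum.asIdeal p.1) φ rfl (s.1 ⟨PrimeSpectrum.comap φ p.1, p.2⟩), fun p => by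
    obtain ⟨V, hV, i, a, f, h⟩ := s.2 ⟨PrimeSpectrum.comap φ p.1, p.2⟩
    refine ⟨(Opens.map (topMap φ)).obj V, hV, (Opens.map (topMap φ)).map i, φ a, φ f, fun q => ?_⟩
    obtain ⟨hf, h⟩ := h ⟨PrimeSpectrum.comap φ q.1, q.2⟩
    exact ⟨hf, (congrArg (Localization.localRingHom (PrimeSpectrum.comap φ q.1).asIdeal
      (PrimeSpectrum.asIdeal q.1) φ rfl) h).trans (Localization.localRingHom_mk _ _ φ rfl a ⟨f, hf⟩)⟩⟩
  map_zero' := Subtype.ext (funext fun _ => map_zero (Localization.localRingHom _ _ φ rfl))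
  map_one' := Subtype.ext (funext fun _ => map_one (Localization.localRingHom _ _ φ rfl))
  map_add' _ _ := Subtype.ext (funext fun _ => map_add (Localization.localRingHom _ _ φ rfl) _ _)
  map_mul' _ _ := Subtype.ext (funext fun _ => map_mul (Localization.localRingHom _ _ φ rfl) _ _)

end

/-- The spectrum of a commutative semiring with its structure sheaf. -/
def sheafedSpace (A : CommSemiRingCat.{u}) : SheafedSpace CommSemiRingCat.{u} where
  carrier := top A
  presheaf := presheaf A
  IsSheaf := presheaf_isSheaf A

/-- The morphism of spectra induced by a homomorphism. -/
def presheafedSpaceMap {A B : CommSemiRingCat.{u}} (φ : A ⟶ B) :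
    (sheafedSpace B).toPresheafedSpace ⟶ (sheafedSpace A).toPresheafedSpace where
  base := topMap φ.hom
  c :=
    { app := fun U => CommSemiRingCat.ofHom (sectionsMap φ.hom U.unop)
      naturality := fun _ _ _ => by
        apply CommSemiRingCat.hom_ext
        rfl }

theorem presheafedSpaceMap_id (A : CommSemiRingCat.{u}) :
    presheafedSpaceMap (𝟙 A) = 𝟙 (sheafedSpace A).toPresheafedSpace := by
  refine PresheafedSpace.hext _ _ rfl (heq_of_eq ?_)
  apply NatTrans.ext
  funext U
  apply CommSemiRingCat.hom_ext
  refine RingHom.ext fun s => Subtype.ext (funext fun p => ?_)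
  exact RingHom.congr_fun (Localization.localRingHom_id (I := PrimeSpectrum.asIdeal p.1)) _

theorem presheafedSpaceMap_comp {A B C : CommSemiRingCat.{u}} (φ : A ⟶ B) (ψ : B ⟶ C) :
    presheafedSpaceMap (φ ≫ ψ) = presheafedSpaceMap ψ ≫ presheafedSpaceMap φ := by
  refine PresheafedSpace.hext _ _ rfl (heq_of_eq ?_)
  apply NatTrans.ext
  funext U
  apply CommSemiRingCat.hom_ext
  refine RingHom.ext fun s => Subtype.ext (funext fun p => ?_)
  exact RingHom.congr_fun (Localization.localRingHom_comp _
    (PrimeSpectrum.comap ψ.hom p.1).asIdeal (PrimeSpectrum.asIdeal p.1) φ.hom rfl ψ.hom rfl) _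

/-- The maps induced on stalks by a morphism of spectra are local homomorphisms. -/
theorem isLocalHom_stalkMap {A B : CommSemiRingCat.{u}} (φ : A ⟶ B) (p : top B) :
    IsLocalHom (PresheafedSpace.Hom.stalkMap (presheafedSpaceMap φ) p).hom where
  map_nonunit x hx := by
    obtain ⟨U, hp, s, rfl⟩ := TopCat.Presheaf.exists_germ_eq (presheaf A) x
    have key : stalkEval p (PresheafedSpace.Hom.stalkMap (presheafedSpaceMap φ) p
        ((presheaf A).germ U _ hp s)) =
        Localization.localRingHom (PrimeSpectrum.comap φ.hom p).asIdeal
          (PrimeSpectrum.asIdeal p) φ.hom rfl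
          (stalkEval (PrimeSpectrum.comap φ.hom p) ((presheaf A).germ U _ hp s)) :=
      (congrArg (stalkEval p)
        (PresheafedSpace.stalkMap_germ_apply (presheafedSpaceMap φ) U p hp s)).trans
        ((stalkEval_germ p ((Opens.map (topMap φ.hom)).obj U) hp (sectionsMap φ.hom U s)).trans
          (congrArg (Localization.localRingHom (PrimeSpectrum.comap φ.hom p).asIdeal
            (PrimeSpectrum.asIdeal p) φ.hom rfl)
            (stalkEval_germ (PrimeSpectrum.comap φ.hom p) U hp s).symm))
    have h1 := hx.map (stalkEval p).hom
    have h2 : IsUnit (Localization.localRingHom (PrimeSpectrum.comap φ.hom p).asIdeal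
          (PrimeSpectrum.asIdeal p) φ.hom rfl
          (stalkEval (PrimeSpectrum.comap φ.hom p) ((presheaf A).germ U _ hp s))) :=
      key ▸ h1
    have h3 := (Localization.isLocalHom_localRingHom (PrimeSpectrum.comap φ.hom p).asIdeal
          (PrimeSpectrum.asIdeal p) φ.hom rfl).map_nonunit _ h2
    exact (isLocalHom_stalkEval (PrimeSpectrum.comap φ.hom p)).map_nonunit _ h3

end SemiSpec

/-! ## Locally semiringed spaces and affine semischemes -/

/-- A locally semiringed space: a topological space with a sheaf of commutative semirings all of
whose stalks are local semirings. -/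
structure LocallySemiringedSpace extends SheafedSpace CommSemiRingCat.{u} where
  isLocalRing : ∀ x, IsLocalRing (presheaf.stalk x)

namespace LocallySemiringedSpace

/-- A morphism of locally semiringed spaces: a continuous map `f : X → Y` with a morphism of sheaves
of semirings `𝒪_Y → f_* 𝒪_X` such that the induced maps on stalks are local homomorphisms. -/
@[ext]
structure Hom (X Y : LocallySemiringedSpace.{u}) where
  hom : X.toPresheafedSpace ⟶ Y.toPresheafedSpace
  isLocalHom : ∀ x, IsLocalHom (PresheafedSpace.Hom.stalkMap hom x).hom

instance : Category LocallySemiringedSpace.{u} where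
  Hom X Y := Hom X Y
  id X :=
    { hom := 𝟙 X.toPresheafedSpace
      isLocalHom := fun x => by
        rw [PresheafedSpace.stalkMap.id]
        exact ⟨fun _ h => h⟩ }
  comp f g :=
    { hom := f.hom ≫ g.hom
      isLocalHom := fun x => by
        rw [PresheafedSpace.stalkMap.comp]
        exact @RingHom.isLocalHom_comp _ _ _ _ _ _ _ _ (f.isLocalHom x) (g.isLocalHom _) }

/-- The contravariant functor sending a commutative semiring `A` to its spectrum
`(Spec A, 𝒪_{Spec A})`. -/
def Spec : CommSemiRingCat.{u}ᵒᵖ ⥤ LocallySemiringedSpace.{u} where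
  obj A :=
    { toSheafedSpace := SemiSpec.sheafedSpace A.unop
      isLocalRing := fun p => SemiSpec.isLocalRing_stalk p }
  map φ :=
    { hom := SemiSpec.presheafedSpaceMap φ.unop
      isLocalHom := SemiSpec.isLocalHom_stalkMap φ.unop }
  map_id A := Hom.ext (SemiSpec.presheafedSpaceMap_id A.unop)
  map_comp φ ψ := Hom.ext (SemiSpec.presheafedSpaceMap_comp ψ.unop φ.unop)

/-- The functor of global sections. -/
def Γ : LocallySemiringedSpace.{u}ᵒᵖ ⥤ CommSemiRingCat.{u} where
  obj X := X.unop.presheaf.obj (op ⊤)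
  map f := f.unop.hom.c.app (op ⊤)
  map_id _ := rfl
  map_comp _ _ := rfl

/-- A locally semiringed space is an affine semischeme if it is isomorphic to the spectrum of some
commutative semiring. -/
def isAffine : ObjectProperty LocallySemiringedSpace.{u} := fun X =>
  ∃ A : CommSemiRingCat.{u}, Nonempty (X ≅ Spec.obj (op A))

end LocallySemiringedSpace

/-- The category of affine semischemes, a full subcategory of the category of locally semiringed
spaces. -/
abbrev AffineSemischeme : Type (u + 1) := LocallySemiringedSpace.isAffine.{u}.FullSubcategory

namespace AffineSemischeme

/-- `A ↦ (Spec A, 𝒪_{Spec A})` as a contravariant functor to affine semischemes. -/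
def Spec : CommSemiRingCat.{u}ᵒᵖ ⥤ AffineSemischeme.{u} :=
  LocallySemiringedSpace.isAffine.lift LocallySemiringedSpace.Spec
    fun A => ⟨A.unop, ⟨Iso.refl _⟩⟩

/-- Global sections, as a contravariant functor from affine semischemes to commutative
semirings. -/
def Γ : AffineSemischeme.{u} ⥤ CommSemiRingCat.{u}ᵒᵖ :=
  LocallySemiringedSpace.isAffine.ι ⋙ LocallySemiringedSpace.Γ.rightOp

end AffineSemischeme

end

noncomputable section

namespace SemiSpec

/-! ### Global sections of the spectrum of `A` are the elements of `A`. -/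

section

variable {A : Type u} [CommSemiring A]

/-! The classical argument for rings survives without subtraction, because differences can be
replaced by cross-multiplied equations. An equation `x = y` is tested through the ideal of all `c`
with `c * x = c * y`, and the radical of an ideal is still the intersection of the primes above it
(`exists_pow_mul_eq`). This gives injectivity of `A → 𝒪(Spec A)`. A finite partition of unity then
glues local fractions, giving surjectivity (`toSections_surjective`). A morphism of spectra is
determined by its effect on global sections (`eq_presheafedSpaceMap`): locality on stalks fixes the
map on points, and local fractions fix the map on sections. So `Spec` is full. It is faithful
because global sections recover `A` naturally, and essentially surjective by the definition of
affine semischemes. -/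

theorem exists_pow_mul_eq (h x y : A)
    (hxy : ∀ p : top A, h ∉ PrimeSpectrum.asIdeal p → algebraMap A (Loc p) x = algebraMap A _ y) :
    ∃ n : ℕ, h ^ n * x = h ^ n * y := by
  -- Equality of the images in the localization at `p` says that `J` is not contained in `p`. Hence
  -- every prime containing `J` contains `h`.
  let J : Ideal A :=
    { carrier := {c | c * x = c * y}
      zero_mem' := by simp
      add_mem' := fun {a b} ha hb => by
        simp only [Set.mem_ofPred_eq] at *
        rw [add_mul, add_mul, ha, hb]
      smul_mem' := fun c a ha => by
        simp only [Set.mem_ofPred_eq, smul_eq_mul] at *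
        rw [mul_assoc, mul_assoc, ha] }
  suffices h ∈ J.radical from this
  rw [Ideal.radical_eq_sInf, Ideal.mem_sInf]
  rintro P ⟨hJP, hP⟩
  by_contra hh
  obtain ⟨c, hc⟩ := (IsLocalization.eq_iff_exists P.primeCompl _).1 (hxy ⟨P, hP⟩ hh)
  exact c.2 (hJP hc)

theorem eq_of_forall_algebraMap_eq {x y : A}
    (hxy : ∀ p : top A, algebraMap A (Loc p) x = algebraMap A _ y) : x = y := by
  obtain ⟨n, hn⟩ := exists_pow_mul_eq 1 x y fun p _ => hxy p
  simpa using hn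

theorem span_eq_top_of_forall_exists_notMem (S : Set A)
    (hS : ∀ p : top A, ∃ h ∈ S, h ∉ PrimeSpectrum.asIdeal p) : Ideal.span S = ⊤ := by
  by_contra hne
  obtain ⟨M, hM, hle⟩ := Ideal.exists_le_maximal _ hne
  obtain ⟨h, hhS, hh⟩ := hS ⟨M, hM.isPrime⟩
  exact hh (hle (Ideal.subset_span hhS))

/-- The section on `U` defined by an element of `A`. -/
def toSections (U : Opens (top A)) : A →+* sections A U where
  toFun a := ⟨fun p => algebraMap A (Loc p.1) a, fun p => ⟨U, p.2, 𝟙 _, a, 1, fun q =>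
    ⟨(Ideal.ne_top_iff_one _).1 q.1.isPrime.ne_top, (Localization.mk_one_eq_algebraMap a).symm⟩⟩⟩
  map_zero' := Subtype.ext (funext fun _ => map_zero (algebraMap A _))
  map_one' := Subtype.ext (funext fun _ => map_one (algebraMap A _))
  map_add' _ _ := Subtype.ext (funext fun _ => map_add (algebraMap A _) _ _)
  map_mul' _ _ := Subtype.ext (funext fun _ => map_mul (algebraMap A _) _ _)

theorem toSections_injective : Function.Injective (toSections (A := A) ⊤) := fun _ _ h =>
  eq_of_forall_algebraMap_eq fun p => congrFun (congrArg Subtype.val h) ⟨p, trivial⟩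

/-- Near every point, a section is a fraction on a basic open set with the same denominator. -/
theorem exists_algebraMap_mul_eq (s : sections A ⊤) (p : top A) :
    ∃ a h : A, h ∉ PrimeSpectrum.asIdeal p ∧ ∀ q : top A, h ∉ PrimeSpectrum.asIdeal q →
      algebraMap A (Loc q) h * s.1 ⟨q, trivial⟩ = algebraMap A _ a := by
  obtain ⟨V, hV, i, a, f, hs⟩ := s.2 ⟨p, trivial⟩
  obtain ⟨_, ⟨g, rfl⟩, hpg, hgV⟩ :=
    PrimeSpectrum.isTopologicalBasis_basic_opens.exists_subset_of_mem_open hV V.2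
  refine ⟨g * a, g * f, (PrimeSpectrum.asIdeal p).primeCompl.mul_mem hpg (hs ⟨p, hV⟩).1,
    fun q hq => ?_⟩
  have hgq : g ∉ PrimeSpectrum.asIdeal q := fun h => hq (Ideal.mul_mem_right _ _ h)
  obtain ⟨hf, h⟩ := hs ⟨q, hgV hgq⟩
  have h' : s.1 ⟨q, trivial⟩ = Localization.mk a ⟨f, hf⟩ := h
  rw [h', Localization.mk_eq_mk', map_mul, map_mul, mul_assoc]
  congr 1
  exact IsLocalization.mk'_spec' (Loc q) a (⟨f, hf⟩ : (PrimeSpectrum.asIdeal q).primeCompl)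

theorem toSections_surjective : Function.Surjective (toSections (A := A) ⊤) := by
  intro s
  choose a h hp hs using exists_algebraMap_mul_eq s
  have hspan : Ideal.span (Set.range h) = ⊤ :=
    span_eq_top_of_forall_exists_notMem _ fun p => ⟨h p, ⟨p, rfl⟩, hp p⟩
  obtain ⟨t, ht⟩ : ∃ t : Finset (top A), Ideal.span (h '' t) = ⊤ := by
    obtain ⟨T, hT, hT'⟩ := (Ideal.span_eq_top_iff_finite _).1 hspan
    classical
    obtain ⟨t, -, ht⟩ := Finset.subset_set_image_iff.1 (Set.image_univ ▸ hT)
    exact ⟨t, by rw [← Finset.coe_image, ht, hT']⟩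
  -- Where `h i * h j` is invertible, both `a i * h j` and `a j * h i` equal `h i * h j * s`.
  have hpair (i j : top A) : ∃ n : ℕ,
      (h i * h j) ^ n * (a i * h j) = (h i * h j) ^ n * (a j * h i) := by
    refine exists_pow_mul_eq _ _ _ fun q hq => ?_
    rw [map_mul, map_mul, ← hs i q fun hi => hq (Ideal.mul_mem_right _ _ hi),
      ← hs j q fun hj => hq (Ideal.mul_mem_left _ _ hj)]
    ring
  choose n hn using hpair
  -- One exponent for all pairs from the finite set `t`.
  let N := t.sup fun i => t.sup fun j => n i j
  have hN (i) (hi : i ∈ t) (j) (hj : j ∈ t) :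
      (h i * h j) ^ N * (a i * h j) = (h i * h j) ^ N * (a j * h i) := by
    have hle : n i j ≤ N := (Finset.le_sup (f := fun j => n i j) hj).trans
      (Finset.le_sup (f := fun i => t.sup fun j => n i j) hi)
    obtain ⟨k, hk⟩ := Nat.exists_eq_add_of_le hle
    rw [hk, add_comm, pow_add, mul_assoc, mul_assoc, hn]
  -- A prime containing all these powers would contain every `h i` with `i ∈ t`. The exponent is `N
  -- + 1` because exchanging `a i * h j` for `a j * h i` in `key` contributes one more factor `h i`.
  have hpow : Ideal.span ((fun i => h i ^ (N + 1)) '' t) = ⊤ := by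
    refine span_eq_top_of_forall_exists_notMem _ fun p => ?_
    by_contra! H
    refine p.isPrime.ne_top (top_le_iff.1 (ht ▸ Ideal.span_le.2 ?_))
    rintro _ ⟨i, hi, rfl⟩
    exact p.isPrime.mem_of_pow_mem _ (H _ ⟨i, hi, rfl⟩)
  obtain ⟨b, hb⟩ : ∃ b : top A → A, ∑ i ∈ t, b i * h i ^ (N + 1) = 1 := by
    have h1 := hpow ▸ Submodule.mem_top (x := (1 : A))
    obtain ⟨b, hb⟩ := (Submodule.mem_span_image_finset_iff_exists_fun' A).1 h1
    exact ⟨b, hb⟩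
  have key (j) (hj : j ∈ t) :
      h j ^ (N + 1) * ∑ i ∈ t, b i * (a i * h i ^ N) = h j ^ N * a j := by
    calc _ = ∑ i ∈ t, b i * ((h i * h j) ^ N * (a i * h j)) := by
          rw [Finset.mul_sum]
          exact Finset.sum_congr rfl fun i _ => by ring
      _ = ∑ i ∈ t, b i * ((h i * h j) ^ N * (a j * h i)) :=
          Finset.sum_congr rfl fun i hi => by rw [hN i hi j hj]
      _ = (∑ i ∈ t, b i * h i ^ (N + 1)) * (h j ^ N * a j) := by
          rw [Finset.sum_mul]
          exact Finset.sum_congr rfl fun i _ => by ring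
      _ = _ := by rw [hb, one_mul]
  -- Since `s = a i * h i ^ N / h i ^ (N + 1)` locally, the partition of unity `∑ b i * h i ^ (N +
  -- 1) = 1` dictates this candidate. At `p` it is compared with `s` after multiplying by the unit
  -- `h j ^ (N + 1)`.
  refine ⟨∑ i ∈ t, b i * (a i * h i ^ N), Subtype.ext (funext fun ⟨p, _⟩ => ?_)⟩
  obtain ⟨j, hj, hjp⟩ : ∃ j ∈ t, h j ∉ PrimeSpectrum.asIdeal p := by
    by_contra! H
    refine p.isPrime.ne_top (top_le_iff.1 (ht ▸ Ideal.span_le.2 ?_))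
    rintro _ ⟨i, hi, rfl⟩
    exact H i hi
  have hu : IsUnit (algebraMap A (Loc p) (h j)) :=
    IsLocalization.map_units (Loc p) (⟨h j, hjp⟩ : (PrimeSpectrum.asIdeal p).primeCompl)
  refine (hu.pow (N + 1)).mul_left_cancel ?_
  change _ * algebraMap A (Loc p) _ = _
  rw [← map_pow, ← map_mul, key j hj, map_mul, ← hs j p hjp, map_pow, map_pow]
  ring

end

/-! ### Morphisms of spectra are determined by global sections. -/

section

/-- The germ of an element of `A` at `p` is invertible if and only if the element is not in `p`. -/
theorem isUnit_germ_toSections_iff {A : Type u} [CommSemiring A] (p : top A) (a : A) :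
    IsUnit ((presheaf A).germ ⊤ p trivial (toSections ⊤ a)) ↔ a ∉ PrimeSpectrum.asIdeal p := by
  have h : stalkEval p ((presheaf A).germ ⊤ p trivial (toSections ⊤ a)) =
    algebraMap A (Loc p) a := stalkEval_germ p ⊤ trivial _
  refine (isUnit_map_iff (stalkEval p).hom _).symm.trans ((iff_of_eq (congrArg IsUnit h)).trans ?_)
  exact IsLocalization.AtPrime.isUnit_to_map_iff (Loc p) (PrimeSpectrum.asIdeal p) a

variable {A B : CommSemiRingCat.{u}}

/-- A morphism of spectra, local on stalks, is determined by its effect on the elements of `A`. -/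
theorem eq_presheafedSpaceMap (φ : A ⟶ B)
    (g : (sheafedSpace B).toPresheafedSpace ⟶ (sheafedSpace A).toPresheafedSpace)
    (hg : ∀ x, IsLocalHom (PresheafedSpace.Hom.stalkMap g x).hom)
    (hφ : ∀ a : A, g.c.app (op ⊤) (toSections ⊤ a : sections A ⊤) =
      (toSections ⊤ (φ a) : sections B ⊤)) :
    g = presheafedSpaceMap φ := by
  -- Since the stalk map is local, the germ of `a` at the image of `p` is a unit exactly when the
  -- germ of `φ a` at `p` is. Thus `a` avoids the image point if and only if `φ a` avoids `p`.
  have hbase : g.base = topMap φ.hom := by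
    refine TopCat.ext fun p => PrimeSpectrum.ext (Ideal.ext fun a => not_iff_not.1 ?_)
    refine (isUnit_germ_toSections_iff _ a).symm.trans
      (Iff.trans ?_ (isUnit_germ_toSections_iff p (φ a)))
    have := hg p
    have e := PresheafedSpace.stalkMap_germ_apply g ⊤ p trivial (toSections ⊤ a : sections A ⊤)
    rw [hφ] at e
    refine (isUnit_map_iff (PresheafedSpace.Hom.stalkMap g p).hom _).symm.trans ?_
    exact iff_of_eq (congrArg IsUnit e)
  obtain ⟨base, c⟩ := g
  change base = _ at hbase
  subst hbase
  refine PresheafedSpace.hext _ _ rfl (heq_of_eq ?_)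
  refine NatTrans.ext (funext fun U => CommSemiRingCat.hom_ext (RingHom.ext fun s => ?_))
  refine Subtype.ext (funext fun p => ?_)
  change sections A U.unop at s
  change ∀ a : A, (c.app (op ⊤)).hom (toSections ⊤ a : sections A ⊤) =
      (toSections ⊤ (φ a) : sections B ⊤) at hφ
  -- Near the image of `p`, `s` satisfies `f * s = a`. Both maps on sections turn this into an
  -- equation with coefficients `φ f` and `φ a`, and `φ f` is invertible at `p`, so the two values
  -- there agree.
  obtain ⟨V, hV, i, a, f, hs⟩ := s.2 ⟨PrimeSpectrum.comap φ.hom p.1, p.2⟩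
  have hres : toSections V f * res i s = toSections V a := by
    refine Subtype.ext (funext fun q => ?_)
    obtain ⟨hf, h⟩ := hs q
    have h' : s.1 ⟨q.1, i.le q.2⟩ = Localization.mk a ⟨f, hf⟩ := h
    change algebraMap A (Loc q.1) f * s.1 ⟨q.1, i.le q.2⟩ = algebraMap A (Loc q.1) a
    rw [h', Localization.mk_eq_mk']
    exact IsLocalization.mk'_spec' (Loc q.1) a (⟨f, hf⟩ : (PrimeSpectrum.asIdeal q.1).primeCompl)
  -- The assumption concerns global sections only; naturality along `V ≤ ⊤` carries it to `V`.
  have hc (a : A) : (c.app (op V)).hom (toSections V a : sections A V) =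
      (toSections ((Opens.map (topMap φ.hom)).obj V) (φ a) : sections B _) := by
    have e := ConcreteCategory.congr_hom (c.naturality (homOfLE le_top : V ⟶ ⊤).op)
      (toSections ⊤ a : sections A ⊤)
    refine Eq.trans e ?_
    change ((presheaf B).map ((Opens.map (topMap φ.hom)).map (homOfLE le_top : V ⟶ ⊤)).op).hom
      ((c.app (op ⊤)).hom (toSections ⊤ a : sections A ⊤)) = _
    rw [hφ a]
    rfl
  have hcs : (c.app (op V)).hom (res i s) =
      res ((Opens.map (topMap φ.hom)).map i) ((c.app U).hom s : sections B _) :=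
    ConcreteCategory.congr_hom (c.naturality i.op) s
  have hcmul := congrArg (c.app (op V)).hom hres
  have h1 : algebraMap B (Loc p.1) (φ f) * ((c.app U).hom s : sections B _).1 p =
      algebraMap B (Loc p.1) (φ a) := by
    have := (map_mul (c.app (op V)).hom _ _).symm.trans hcmul
    rw [hc, hc, hcs] at this
    exact congrFun (congrArg Subtype.val this) ⟨p.1, hV⟩
  obtain ⟨hf, h⟩ := hs ⟨_, hV⟩
  have hu : IsUnit (algebraMap B (Loc p.1) (φ f)) := IsLocalization.map_units (Loc p.1)
    (⟨φ f, hf⟩ : (PrimeSpectrum.asIdeal p.1).primeCompl)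
  refine hu.mul_left_cancel (h1.trans ?_)
  have h2 := congrFun (congrArg Subtype.val hres) ⟨_, hV⟩
  have h3 := congrArg (Localization.localRingHom (PrimeSpectrum.comap φ.hom p.1).asIdeal
    (PrimeSpectrum.asIdeal p.1) φ.hom rfl) h2
  have h4 := (map_mul (Localization.localRingHom (PrimeSpectrum.comap φ.hom p.1).asIdeal
    (PrimeSpectrum.asIdeal p.1) φ.hom rfl) _ _).symm.trans h3
  refine (Localization.localRingHom_to_map _ _ φ.hom rfl a).symm.trans (h4.symm.trans ?_)
  exact congrArg (· * _) (Localization.localRingHom_to_map _ _ φ.hom rfl f)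

/-- A commutative semiring is isomorphic to the global sections of its spectrum. -/
def globalSectionsEquiv (A : Type u) [CommSemiring A] : A ≃+* sections A ⊤ :=
  RingEquiv.ofBijective (toSections ⊤) ⟨toSections_injective, toSections_surjective⟩

theorem sectionsMap_toSections {A B : Type u} [CommSemiring A] [CommSemiring B] (φ : A →+* B)
    (U : Opens (top A)) (a : A) : sectionsMap φ U (toSections U a) = toSections _ (φ a) :=
  Subtype.ext (funext fun _ => Localization.localRingHom_to_map _ _ φ rfl a)

end

end SemiSpec

/-! ### The equivalence of categories. -/

namespace LocallySemiringedSpace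

instance full_Spec : Spec.{u}.Full where
  map_surjective {X Y} g := by
    -- The only possible candidate: the effect of `g` on global sections, read through
    -- `globalSectionsEquiv`.
    let φ : Y.unop ⟶ X.unop := CommSemiRingCat.ofHom
      (((SemiSpec.globalSectionsEquiv X.unop).symm.toRingHom.comp (g.hom.c.app (op ⊤)).hom).comp
        (SemiSpec.toSections ⊤))
    exact ⟨φ.op, Hom.ext (SemiSpec.eq_presheafedSpaceMap φ g.hom g.isLocalHom fun a =>
      ((SemiSpec.globalSectionsEquiv X.unop).apply_symm_apply _).symm).symm⟩

end LocallySemiringedSpace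

namespace AffineSemischeme

/-- The global sections of the spectrum of `A` are naturally isomorphic to `A`. -/
def SpecΓIso : Spec.{u} ⋙ Γ ≅ 𝟭 CommSemiRingCat.{u}ᵒᵖ :=
  NatIso.ofComponents
    (fun X => (SemiSpec.globalSectionsEquiv X.unop).toCommSemiRingCatIso.op)
    fun φ => Quiver.Hom.unop_inj (CommSemiRingCat.hom_ext (RingHom.ext fun a =>
      SemiSpec.sectionsMap_toSections φ.unop.hom ⊤ a))

instance full_Spec : Spec.{u}.Full :=
  have : LocallySemiringedSpace.Spec.{u}.Full := LocallySemiringedSpace.full_Spec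
  Functor.Full.of_comp_faithful_iso (LocallySemiringedSpace.isAffine.liftCompιIso
    LocallySemiringedSpace.Spec.{u} fun A => ⟨A.unop, ⟨Iso.refl _⟩⟩)

instance faithful_Spec : Spec.{u}.Faithful :=
  Functor.Faithful.of_comp_iso SpecΓIso

instance essSurj_Spec : Spec.{u}.EssSurj where
  mem_essImage X := by
    obtain ⟨A, ⟨i⟩⟩ := X.property
    exact ⟨op A, ⟨LocallySemiringedSpace.isAffine.isoMk i.symm⟩⟩

instance isEquivalence_Spec : Spec.{u}.IsEquivalence where

end AffineSemischeme

end

theorem mainTheorem3 :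
    ∃ e : CommSemiRingCat.{u}ᵒᵖ ≌ AffineSemischeme.{u},
      e.functor = AffineSemischeme.Spec.{u} ∧ e.inverse = AffineSemischeme.Γ.{u} := by
  let e := AffineSemischeme.Spec.{u}.asEquivalence
  -- The inverse in `e` is an abstract choice. Inserting `Spec ⋙ Γ ≅ 𝟭` and cancelling `e.inverse ⋙
  -- Spec` by the counit identifies it with `Γ`; `changeInverse` then makes both required equalities
  -- definitional.
  let i : e.inverse ≅ AffineSemischeme.Γ.{u} :=
    (Functor.rightUnitor _).symm ≪≫
      Functor.isoWhiskerLeft e.inverse AffineSemischeme.SpecΓIso.symm ≪≫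
      (Functor.associator _ _ _).symm ≪≫ Functor.isoWhiskerRight e.counitIso _ ≪≫
      Functor.leftUnitor _
  exact ⟨e.changeInverse i, rfl, rfl⟩
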